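/- **Conventions.** Let $\mathcal C$ be a finitely complete category. A map $\pi\colon E\to B$ is *exponentiable* if pullback $\pi^*\colon \mathcal C/B\to\mathcal C/E$ has a right adjoint $\pi_*$ (pushforward). A *universal map* is an exponentiable map $\pi\colon E\to B$ together with a *universe structure*, i.e. a choice of a right adjoint to postcomposition $\pi_!\colon\mathcal C/E\to\mathcal C/B$ (a choice of pullbacks along $\pi$); the counit $\pi_A\colon\Gamma.A\to\Gamma$ at $A\colon\Gamma\to B$ is the *selected pullback* of $\pi$ along $A$. A *$\pi$-fibrancy structure* on a map $f\colon X\to Y$ is a pair of maps $Y\to B$, $X\to E$ forming with $f$ and $\pi$ a pullback square; it is *canonical* if $f$, with the map $X\to E$, is the selected pullback of $\pi$ along $Y\to B$. A *$\pi$-fibration* is a map admitting a $\pi$-fibrancy structure. A map $\pi'\colon E'\to B'$ is an *internal universe* of the universal map $\pi$ if it is equipped with the structure of a universal map and if, for some terminal object $1$, both $\pi'$ and $B'\to 1$ are equipped with canonical $\pi$-fibrancy structures. For an exponentiable $p\colon E\to B$, the polynomial functor is $\mathbf P_p(X)=\mathrm{dom}\,(p_*(E\times X)\to B)$. A *$\Pi$-type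 structure* on a universal map $\pi$ is a $\pi$-fibrancy structure on $\mathbf P_\pi(\pi)\colon \mathbf P_\pi(E)\to\mathbf P_\pi(B)$. For a map $p'\colon E'\to B'$, the *generic composite* $\mathrm{GenComp}(p',p)$ is the composite $\mathrm{ev}^*E'\to p^*p_*(E\times B')\to p_*(E\times B')$, where the second map is the pullback of $p$ along $p_*(E\times B')\to B$ and the first is the pullback of $p'$ along $\mathrm{ev}\colon p^*p_*(E\times B')\to E\times B'\to B'$ (the counit followed by the projection). **Theorem.** Let $M\colon\mathcal C_0\to\mathcal C_1$ be a functor between finitely complete categories that preserves finite limits. For $i=0,1$ let $\pi_i\colon\widetilde{\mathcal U}_i\to\mathcal U_i$ be a universal map in $\mathcal C_i$ with an internal universe $\pi_i^{\mathsf{ds}}\colon\widetilde{\mathcal U}{}_i^{\mathsf{ds}}\to\mathcal U_i^{\mathsf{ds}}$. Suppose that $M$ takes $\pi_0$-fibrations to $\pi_1$-fibrations and that $\pi_1$ has a $\Pi$-type structure. Let $\mathrm{Gl}(M)$ be the comma category $\mathcal C_1\downarrow M$, whose objects are the maps $X\colon X_1\to MX_0$ in $\mathcal C_1$. Call a map $f\colon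 E\to B$ of $\mathrm{Gl}(M)$ a *Reedy fibration* if $f_0\colon E_0\to B_0$ is a $\pi_0$-fibration and the relative matching map $E_1\to B_1\times_{MB_0}ME_0$ is a $\pi_1$-fibration, and an *internal Reedy fibration* if the same holds with $\pi_i^{\mathsf{ds}}$ in place of $\pi_i$. Then $\mathrm{Gl}(M)$ is finitely complete, and $M\pi_0$ and $M\pi_0^{\mathsf{ds}}$ are exponentiable. Moreover, for any choice of pullbacks and pushforwards along these two maps, let $\tau\colon\widetilde{\mathcal V}\to\mathcal V$ be the map of $\mathrm{Gl}(M)$ with $0$-component $\pi_0$ and $1$-component $\mathrm{GenComp}(\pi_1,M\pi_0)$, where $\mathcal V$ is the projection $\mathbf P_{M\pi_0}(\mathcal U_1)\to M\mathcal U_0$ and $\widetilde{\mathcal V}$ is the composite $\mathrm{ev}^*\widetilde{\mathcal U}_1\to (M\pi_0)^*\mathbf P_{M\pi_0}(\mathcal U_1)\to M\widetilde{\mathcal U}_0$. Let $\tau^{\mathsf{ds}}$ be the map obtained in the same way from $\pi_0^{\mathsf{ds}}$ and $\pi_1^{\mathsf{ds}}$. Then: 1. a map of $\mathrm{Gl}(M)$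 is a Reedy fibration if and only if it is a $\tau$-fibration; 2. a map of $\mathrm{Gl}(M)$ is an internal Reedy fibration if and only if it is a $\tau^{\mathsf{ds}}$-fibration; 3. $\tau$ and $\tau^{\mathsf{ds}}$ can be equipped with structures of universal maps for which $\tau^{\mathsf{ds}}$ is an internal universe of $\tau$. -/

import Mathlib

open CategoryTheory CategoryTheory.Limits

universe v u v₀ u₀ v₁ u₁

namespace GluedUniverse

noncomputable section

section Universes

variable {C : Type u} [Category.{v} C]

/-- A universal map: a map `π` with a chosen right adjoint `Over B ⥤ Over E` of postcomposition
with `π` (its universe structure, i.e. a choice of pullbacks along `π`), which is exponentiable,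
i.e. the pullback functor has a right adjoint, of which a choice (the pushforward) is included. -/
structure UniversalMap {E B : C} (π : E ⟶ B) where
  [pullbacks : ChosenPullbacksAlong π]
  [pushforwards : ExponentiableMorphism π]

namespace UniversalMap

variable {E B : C} {π : E ⟶ B} (u : UniversalMap π)

/-- The pullback functor along `π` selected by the universe structure. -/
def pull : Over B ⥤ Over E := u.pullbacks.pullback

/-- The pushforward functor along `π`. -/
def push : Over E ⥤ Over B := u.pushforwards.pushforward

/-- Postcomposition with `π` is left adjoint to selected pullback along `π`. -/
def mapPullAdj : Over.map π ⊣ u.pull :=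
  letI := u.pullbacks
  ChosenPullbacksAlong.mapPullbackAdj π

/-- Selected pullback along `π` is left adjoint to pushforward along `π`. -/
def pullPushAdj : u.pull ⊣ u.push :=
  letI := u.pullbacks
  letI := u.pushforwards
  ExponentiableMorphism.pullbackPushforwardAdj π

/-- The context extension `Γ.A`. -/
def ext {Γ : C} (A : Γ ⟶ B) : C := (u.pull.obj (Over.mk A)).left

/-- The map `Γ.A ⟶ E` of the selected pullback of `π` along `A`. -/
def var {Γ : C} (A : Γ ⟶ B) : u.ext A ⟶ E := (u.pull.obj (Over.mk A)).hom

/-- The selected pullback `Γ.A ⟶ Γ` of `π` along `A`, the counit at `A`. -/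
def disp {Γ : C} (A : Γ ⟶ B) : u.ext A ⟶ Γ := (u.mapPullAdj.counit.app (Over.mk A)).left

end UniversalMap

/-- A `π`-fibrancy structure on `f`: a name and a point that exhibit `f` as a pullback of `π`. -/
structure FibrancyStructure {E B : C} (π : E ⟶ B) {X Y : C} (f : X ⟶ Y) where
  name : Y ⟶ B
  point : X ⟶ E
  isPullback : IsPullback point f π name

/-- A `π`-fibration is a map that admits a `π`-fibrancy structure. -/
def IsFibration {E B : C} (π : E ⟶ B) {X Y : C} (f : X ⟶ Y) : Prop :=
  Nonempty (FibrancyStructure π f)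

/-- `(name, point)` is the canonical fibrancy structure of `f`: the map `f` is (on the nose) the
pullback of `π` along `name` which the universe structure selects. -/
inductive UniversalMap.IsCanonical {E B : C} {π : E ⟶ B} (u : UniversalMap π) :
    ∀ {X Y : C} (_ : X ⟶ Y) (_ : Y ⟶ B) (_ : X ⟶ E), Prop
  | selected {Γ : C} (A : Γ ⟶ B) : u.IsCanonical (u.disp A) A (u.var A)

/-- A canonical fibrancy structure on `f`, relative to the universe structure of `π`. -/
structure CanonicalFibrancyStructure {E B : C} {π : E ⟶ B} (u : UniversalMap π)
    {X Y : C} (f : X ⟶ Y) extends FibrancyStructure π f where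
  canonical : u.IsCanonical f name point

/-- `π'` is an internal universe of the universal map `π`: it is a universal map, and for a
terminal object `one` both `π'` and `B' ⟶ one` have canonical `π`-fibrancy structures. -/
structure InternalUniverse {E B : C} {π : E ⟶ B} (u : UniversalMap π)
    {E' B' : C} (π' : E' ⟶ B') where
  univ : UniversalMap π'
  one : C
  isTerminal : IsTerminal one
  el : CanonicalFibrancyStructure u π'
  base : CanonicalFibrancyStructure u (isTerminal.from B')

end Universes

section Polynomials

variable {C : Type u} [Category.{v} C] [HasFiniteLimits C] {E B : C} {p : E ⟶ B}
  (e : UniversalMap p)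

/-- The object `p_*(E × X)` of the slice over `B`. -/
def polyOver (X : C) : Over B := e.push.obj (Over.mk (prod.fst : E ⨯ X ⟶ E))

/-- The value of the polynomial functor of `p` at an object `X`. -/
def poly (X : C) : C := (polyOver e X).left

/-- The projection `p_*(E × X) ⟶ B`. -/
def polyProj (X : C) : poly e X ⟶ B := (polyOver e X).hom

/-- The action of the polynomial functor of `p` on a map `g`, namely `p_*(E × g)`. -/
def polyMap {X Y : C} (g : X ⟶ Y) : poly e X ⟶ poly e Y :=
  (e.push.map (Over.homMk (prod.map (𝟙 E) g) (by simp) :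
    Over.mk (prod.fst : E ⨯ X ⟶ E) ⟶ Over.mk (prod.fst : E ⨯ Y ⟶ E))).left

/-- A `Π`-type structure on a universal map: a fibrancy structure on the map obtained by applying
the polynomial functor of the map to the map itself. -/
abbrev PiStructure : Type _ := FibrancyStructure p (polyMap e p)

variable {E' B' : C} (p' : E' ⟶ B')

/-- The object `p^* p_*(E × B')` of the slice over `E`. -/
def genCompMidOver (B' : C) : Over E := e.pull.obj (polyOver e B')

/-- The object `p^* p_*(E × B')`. -/
def genCompMid (B' : C) : C := (genCompMidOver e B').left

/-- The projection `p^* p_*(E × B') ⟶ E`. -/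
def genCompMidProj (B' : C) : genCompMid e B' ⟶ E := (genCompMidOver e B').hom

/-- The counit `p^* p_*(E × B') ⟶ E × B'` followed by the projection to `B'`. -/
def evMap (B' : C) : genCompMid e B' ⟶ B' :=
  (e.pullPushAdj.counit.app (Over.mk (prod.fst : E ⨯ B' ⟶ E))).left ≫ prod.snd

/-- The object `ev^*(E × E')`, the pullback of `p'` along `evMap`. -/
def genCompTop : C := pullback (evMap e B') p'

/-- The first map of the generic composite, the pullback of `p'` along `evMap`. -/
def genCompFst : genCompTop e p' ⟶ genCompMid e B' := pullback.fst (evMap e B') p'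

/-- The second map of the generic composite, the pullback of `p` along `p_*(E × B') ⟶ B`. -/
def genCompSnd (B' : C) : genCompMid e B' ⟶ poly e B' :=
  (e.mapPullAdj.counit.app (polyOver e B')).left

/-- The generic composite `GenComp(p', p)`. -/
def genComp : genCompTop e p' ⟶ poly e B' := genCompFst e p' ≫ genCompSnd e B'

theorem genCompSnd_comp (B' : C) :
    genCompSnd e B' ≫ polyProj e B' = genCompMidProj e B' ≫ p :=
  Over.w (e.mapPullAdj.counit.app (polyOver e B'))

end Polynomials

section Gluing

variable {C₀ : Type u₀} [Category.{v₀} C₀] {C₁ : Type u₁} [Category.{v₁} C₁]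

/-- The Artin–Wraith gluing category `C₁ ↓ M`. For an object `X`, `X.right` is the 0-component,
`X.left` is the 1-component and `X.hom : X.left ⟶ M.obj X.right` is the structure map. -/
abbrev Gl (M : C₀ ⥤ C₁) : Type (max u₁ u₀ v₁) := Comma (𝟭 C₁) M

section RelativeMatching

variable [HasFiniteLimits C₁] {M : C₀ ⥤ C₁}

/-- The relative matching object of a map of the gluing category. -/
def relMatchObj {Y X : Gl M} (f : Y ⟶ X) : C₁ := pullback X.hom (M.map f.right)

/-- The relative matching map of a map of the gluing category. -/
def relMatchMap {Y X : Gl M} (f : Y ⟶ X) : Y.left ⟶ relMatchObj f :=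
  pullback.lift f.left Y.hom f.w

/-- A Reedy fibration relative to `π₀` and `π₁`. -/
def IsReedyFibration {E₀ B₀ : C₀} (π₀ : E₀ ⟶ B₀) {E₁ B₁ : C₁} (π₁ : E₁ ⟶ B₁)
    {Y X : Gl M} (f : Y ⟶ X) : Prop :=
  IsFibration π₀ f.right ∧ IsFibration π₁ (relMatchMap f)

end RelativeMatching

section ReedyMap

variable [HasFiniteLimits C₁] {M : C₀ ⥤ C₁} {E₀ B₀ : C₀} (π₀ : E₀ ⟶ B₀)
  {E₁ B₁ : C₁} (π₁ : E₁ ⟶ B₁) (e : UniversalMap (M.map π₀))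

/-- The codomain of the glued map: the polynomial functor of `M π₀` applied to `B₁`, with its
projection to `M B₀`. -/
def reedyBase (B₁ : C₁) : Gl M where
  left := poly e B₁
  right := B₀
  hom := polyProj e B₁

/-- The domain of the glued map: the domain of `GenComp(π₁, M π₀)`, with its projection to
`M E₀`. -/
def reedyTotal : Gl M where
  left := genCompTop e π₁
  right := E₀
  hom := genCompFst e π₁ ≫ genCompMidProj e B₁

/-- The map of the gluing category with 0-component `π₀` and 1-component `GenComp(π₁, M π₀)`,
for chosen pullbacks and pushforwards along `M π₀`. -/
def reedyMap : reedyTotal π₀ π₁ e ⟶ reedyBase π₀ e B₁ where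
  left := genComp e π₁
  right := π₀
  w := by
    change genComp e π₁ ≫ polyProj e B₁ = (genCompFst e π₁ ≫ genCompMidProj e B₁) ≫ M.map π₀
    rw [genComp, Category.assoc, Category.assoc, genCompSnd_comp]

end ReedyMap

end Gluing

end

end GluedUniverse

open GluedUniverse

/-! Classification: if `f.right` is the pullback of `π₀` along a name, then the relative matching
object of `f` is a pullback of `M π₀`. A lift of the resulting map `X.left ⟶ M B₀` to `P_{Mπ₀}(B₁)`
is, by transposition, a map from the matching object to `B₁`, that is, a name for a `π₁`-fibration
over it. As pullbacks in the gluing category are componentwise, the two data of a Reedy fibration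
amount to one pullback square over `τ` (`isReedyFibration_iff`).

Exponentiability: pushforwards are described by a universal property tested against arbitrary
pullback squares, independent of chosen functors. In this form they are stable under base change and
composition, which covers `M π₀` and the generic composites, and they can be glued from pushforwards
of the two components (`Gl.hasPushforwards`).

Internal universe: `τ'`, the glued map of `π₀'` and `π₁'`, is an internal Reedy fibration, hence a
Reedy fibration, hence a `τ`-fibration. Its codomain is Reedy fibrant because its matching map over
the terminal object is a pushforward along `M π₀'` of a product projection, and `Π`-types keep this
a `π₁`-fibration (`isFibration_of_isPushforward`). Both fibrancy structures become canonical by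
choosing the universe structure on `τ` to select them; coinciding names need separate care
(`exists_internalUniverse`). -/

namespace GluedUniverse

/-! ### Pushforwards by universal property, and their relation to adjoints. -/

section Pushforward

variable {C : Type u} [Category.{v} C]

/-- Given a cospan of a projection `s : K ⟶ P` and an evaluation `ev : K ⟶ X`, the map
`h : Z ⟶ P` is the transpose of `g : L ⟶ X` relative to `m : L ⟶ Z`. -/
def IsTranspose {X P K L Z : C} (s : K ⟶ P) (ev : K ⟶ X) (m : L ⟶ Z) (h : Z ⟶ P)
    (g : L ⟶ X) : Prop :=
  ∃ t : L ⟶ K, t ≫ s = m ≫ h ∧ t ≫ ev = g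

/-- `r : P ⟶ B` is a pushforward of `q : X ⟶ E` along `p : E ⟶ B`, where `K` is the pullback of
`p` along `r` and `ev : K ⟶ X` is the evaluation. -/
structure IsPushforward {X E B P K : C} (q : X ⟶ E) (p : E ⟶ B) (r : P ⟶ B) (k : K ⟶ E)
    (s : K ⟶ P) (ev : K ⟶ X) : Prop where
  isPullback : IsPullback k s p r
  ev_comp : ev ≫ q = k
  existsUnique : ∀ {L Z : C} {l : L ⟶ E} {m : L ⟶ Z} {z : Z ⟶ B}, IsPullback l m p z →
    ∀ g : L ⟶ X, g ≫ q = l → ∃! h : Z ⟶ P, h ≫ r = z ∧ IsTranspose s ev m h g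

/-- Every map with codomain `E` has a pushforward along `p`. -/
def HasPushforwards {E B : C} (p : E ⟶ B) : Prop :=
  ∀ (X : C) (q : X ⟶ E), ∃ (P K : C) (r : P ⟶ B) (k : K ⟶ E) (s : K ⟶ P) (ev : K ⟶ X),
    IsPushforward q p r k s ev

theorem IsTranspose.precomp {X P K L Z L' Z' : C} {s : K ⟶ P} {ev : K ⟶ X} {m : L ⟶ Z}
    {h : Z ⟶ P} {g : L ⟶ X} (H : IsTranspose s ev m h g) {m' : L' ⟶ Z'} {u : L' ⟶ L}
    {v : Z' ⟶ Z} (w : u ≫ m = m' ≫ v) : IsTranspose s ev m' (v ≫ h) (u ≫ g) := by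
  obtain ⟨t, h₁, h₂⟩ := H
  exact ⟨u ≫ t, by rw [Category.assoc, h₁, reassoc_of% w], by rw [Category.assoc, h₂]⟩

theorem IsTranspose.postcomp {X P K L Z X' P' K' : C} {s : K ⟶ P} {ev : K ⟶ X} {m : L ⟶ Z}
    {h : Z ⟶ P} {g : L ⟶ X} (H : IsTranspose s ev m h g) {s' : K' ⟶ P'} {ev' : K' ⟶ X'}
    {a : X ⟶ X'} {b : P ⟶ P'} (H' : IsTranspose s' ev' s b (ev ≫ a)) :
    IsTranspose s' ev' m (h ≫ b) (g ≫ a) := by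
  obtain ⟨t, h₁, h₂⟩ := H
  obtain ⟨t', h₁', h₂'⟩ := H'
  exact ⟨t ≫ t', by rw [Category.assoc, h₁', reassoc_of% h₁],
    by rw [Category.assoc, h₂', reassoc_of% h₂]⟩

namespace IsPushforward

variable {X E B P K : C} {q : X ⟶ E} {p : E ⟶ B} {r : P ⟶ B} {k : K ⟶ E} {s : K ⟶ P}
  {ev : K ⟶ X} (H : IsPushforward q p r k s ev)
include H

theorem exists_lift {L Z : C} {l : L ⟶ E} {m : L ⟶ Z} {z : Z ⟶ B} (hL : IsPullback l m p z)
    (g : L ⟶ X) (hg : g ≫ q = l) : ∃ h : Z ⟶ P, h ≫ r = z ∧ IsTranspose s ev m h g :=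
  (H.existsUnique hL g hg).exists

theorem hom_ext {L Z : C} {l : L ⟶ E} {m : L ⟶ Z} {z : Z ⟶ B} (hL : IsPullback l m p z)
    {g : L ⟶ X} (hg : g ≫ q = l) {h h' : Z ⟶ P} (hr : h ≫ r = z) (hr' : h' ≫ r = z)
    (hh : IsTranspose s ev m h g) (hh' : IsTranspose s ev m h' g) : h = h' :=
  (H.existsUnique hL g hg).unique ⟨hr, hh⟩ ⟨hr', hh'⟩

theorem exists_transpose {L Z : C} {l : L ⟶ E} {m : L ⟶ Z} {h : Z ⟶ P}
    (w : l ≫ p = m ≫ h ≫ r) : ∃ g : L ⟶ X, g ≫ q = l ∧ IsTranspose s ev m h g := by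
  obtain ⟨t, h₁, h₂⟩ := H.isPullback.exists_lift l (m ≫ h) (by simpa using w)
  exact ⟨t ≫ ev, by rw [Category.assoc, H.ev_comp, h₁], t, h₂, rfl⟩

theorem isTranspose_unique {L Z : C} {m : L ⟶ Z} {h : Z ⟶ P} {g g' : L ⟶ X}
    (hg : g ≫ q = g' ≫ q) (hh : IsTranspose s ev m h g) (hh' : IsTranspose s ev m h g') :
    g = g' := by
  obtain ⟨t, h₁, rfl⟩ := hh
  obtain ⟨t', h₁', rfl⟩ := hh'
  simp only [Category.assoc, H.ev_comp] at hg
  rw [H.isPullback.hom_ext hg (h₁.trans h₁'.symm)]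

end IsPushforward

/-- The hom-set bijection of the adjunction, read off on underlying maps, is the universal property
of the pullback. -/
theorem isPullback_of_mapAdj {E B : C} {p : E ⟶ B} {G : Over B ⥤ Over E} (adj : Over.map p ⊣ G)
    (A : Over B) : IsPullback (G.obj A).hom (adj.counit.app A).left p A.hom := by
  refine IsPullback.mk' (Over.w (adj.counit.app A)).symm ?_ ?_
  · intro T φ φ' h₁ h₂
    let f : Over.mk (φ ≫ (G.obj A).hom) ⟶ G.obj A := Over.homMk φ
    let f' : Over.mk (φ ≫ (G.obj A).hom) ⟶ G.obj A := Over.homMk φ' h₁.symm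
    have : f = f' := by
      apply (adj.homEquiv _ _).symm.injective
      ext
      simpa [Adjunction.homEquiv_counit, f, f'] using h₂
    exact congrArg (fun x => x.left) this
  · intro T a b w
    let g : (Over.map p).obj (Over.mk a) ⟶ A := Over.homMk b (by simpa using w.symm)
    refine ⟨(adj.homEquiv _ _ g).left, Over.w (adj.homEquiv _ _ g), ?_⟩
    have := (adj.homEquiv _ _).symm_apply_apply g
    rw [Adjunction.homEquiv_counit] at this
    simpa [g] using congrArg (fun x => x.left) this

theorem UniversalMap.isPullback {E B : C} {p : E ⟶ B} (u : UniversalMap p) (A : Over B) :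
    IsPullback (u.pull.obj A).hom (u.mapPullAdj.counit.app A).left p A.hom :=
  isPullback_of_mapAdj u.mapPullAdj A

/-- An arbitrary pullback `L` is canonically isomorphic to the selected one; across this
isomorphism, transposes are those of the adjunction `pullPushAdj`. -/
theorem UniversalMap.isPushforward {E B : C} {p : E ⟶ B} (u : UniversalMap p) (X : Over E) :
    IsPushforward X.hom p (u.push.obj X).hom (u.pull.obj (u.push.obj X)).hom
      (u.mapPullAdj.counit.app (u.push.obj X)).left (u.pullPushAdj.counit.app X).left where
  isPullback := u.isPullback _
  ev_comp := Over.w (u.pullPushAdj.counit.app X)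
  existsUnique {L Z l m z} hL g hg := by
    have hA := u.isPullback (Over.mk z)
    let i := hL.isoIsPullback _ _ hA
    have hi₁ : i.inv ≫ l = _ := hL.isoIsPullback_inv_fst _ _ hA
    have hi₂ : i.hom ≫ (u.mapPullAdj.counit.app (Over.mk z)).left = m :=
      hL.isoIsPullback_hom_snd _ _ hA
    have hi₃ : i.hom ≫ (u.pull.obj (Over.mk z)).hom = l := hL.isoIsPullback_hom_fst _ _ hA
    let g' : u.pull.obj (Over.mk z) ⟶ X := Over.homMk (i.inv ≫ g) (by
      rw [Category.assoc, hg, hi₁])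
    have nat (h' : Over.mk z ⟶ u.push.obj X) :
        (u.pull.map h').left ≫ (u.mapPullAdj.counit.app (u.push.obj X)).left =
          (u.mapPullAdj.counit.app (Over.mk z)).left ≫ h'.left :=
      congrArg (fun x => x.left) (u.mapPullAdj.counit.naturality h')
    refine ⟨(u.pullPushAdj.homEquiv _ _ g').left, ⟨Over.w (u.pullPushAdj.homEquiv _ _ g'),
      i.hom ≫ (u.pull.map (u.pullPushAdj.homEquiv _ _ g')).left, ?_, ?_⟩, ?_⟩
    · rw [Category.assoc, nat, reassoc_of% hi₂]
    · have := (u.pullPushAdj.homEquiv _ _).symm_apply_apply g'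
      rw [Adjunction.homEquiv_counit] at this
      have := congrArg (fun x => i.hom ≫ x.left) this
      simpa [g'] using this
    · rintro h ⟨hr, t, h₁, h₂⟩
      let h' : Over.mk z ⟶ u.push.obj X := Over.homMk h hr
      have ht : i.inv ≫ t = (u.pull.map h').left := by
        apply (u.isPullback (u.push.obj X)).hom_ext
        · have e₁ := Over.w (u.pullPushAdj.counit.app X)
          have e₂ := Over.w (u.pull.map h')
          simp only [Functor.id_obj, Functor.comp_obj] at e₁
          rw [e₂, Category.assoc, ← e₁, reassoc_of% h₂, hg, hi₁]
        · rw [nat, Category.assoc, h₁, ← hi₂]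
          simp [h']
      have : u.pullPushAdj.homEquiv _ _ g' = h' := by
        rw [← Equiv.eq_symm_apply, Adjunction.homEquiv_counit]
        ext
        simp [g', ← ht, h₂]
      rw [this]
      rfl

theorem UniversalMap.hasPushforwards {E B : C} {p : E ⟶ B} (u : UniversalMap p) :
    HasPushforwards p := fun _ q =>
  ⟨_, _, _, _, _, _, u.isPushforward (Over.mk q)⟩

/-- A right adjoint may be constructed objectwise: `P` over `B` represents the maps `G.obj A ⟶ X`
because each `G.obj A` is a pullback of `p`. -/
theorem HasPushforwards.isLeftAdjoint {E B : C} {p : E ⟶ B} (hp : HasPushforwards p)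
    {G : Over B ⥤ Over E} (adj : Over.map p ⊣ G) : G.IsLeftAdjoint := by
  apply Functor.isLeftAdjoint_of_rightAdjointObjIsDefined_eq_top
  ext X
  simp only [Pi.top_apply, Prop.top_eq_true, iff_true]
  obtain ⟨P, K, r, k, s, ev, H⟩ := hp _ X.hom
  have hA (A : Over B) := isPullback_of_mapAdj adj A
  let κ : (G.obj (Over.mk r)).left ⟶ K := (H.isPullback.lift _ _ (hA (Over.mk r)).w)
  have hκ₁ : κ ≫ k = (G.obj (Over.mk r)).hom := H.isPullback.lift_fst _ _ _
  have hκ₂ : κ ≫ s = (adj.counit.app (Over.mk r)).left := H.isPullback.lift_snd _ _ _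
  let ε : G.obj (Over.mk r) ⟶ X := Over.homMk (κ ≫ ev) (by
    rw [Category.assoc, H.ev_comp, hκ₁])
  have nat {A : Over B} (h' : A ⟶ Over.mk r) :
      (G.map h').left ≫ (adj.counit.app (Over.mk r)).left =
        (adj.counit.app A).left ≫ h'.left :=
    congrArg (fun x => x.left) (adj.counit.naturality h')
  have htr {A : Over B} (h : A ⟶ Over.mk r) : IsTranspose s ev (adj.counit.app A).left h.left
      (G.map h ≫ ε).left :=
    ⟨(G.map h).left ≫ κ, by rw [Category.assoc, hκ₂, nat], by simp [ε]⟩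
  refine Functor.RepresentableBy.isRepresentable (Y := Over.mk r)
    { homEquiv := fun {A} => Equiv.ofBijective (fun h => G.map h ≫ ε) ⟨?_, ?_⟩
      homEquiv_comp := ?_ }
  · intro h h' e
    ext
    refine H.hom_ext (hA A) (Over.w (G.map h ≫ ε)) (Over.w h) (Over.w h') (htr h) ?_
    have := htr h'
    dsimp only at e
    rwa [← e] at this
  · intro g
    obtain ⟨h, hr, hh⟩ := H.exists_lift (hA A) g.left (Over.w g)
    refine ⟨Over.homMk h hr, ?_⟩
    refine Over.OverMorphism.ext ?_
    refine H.isTranspose_unique ?_ (htr (Over.homMk h hr)) hh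
    rw [Over.w g]
    exact Over.w (G.map _ ≫ ε)
  · intro A A' f g
    exact (congrArg (· ≫ ε) (G.map_comp f g)).trans (Category.assoc _ _ _)

theorem IsPushforward.of_exists_of_ext {X E B P K : C} {q : X ⟶ E} {p : E ⟶ B} {r : P ⟶ B}
    {k : K ⟶ E} {s : K ⟶ P} {ev : K ⟶ X} (hK : IsPullback k s p r) (hev : ev ≫ q = k)
    (ex : ∀ {L Z : C} {l : L ⟶ E} {m : L ⟶ Z} {z : Z ⟶ B}, IsPullback l m p z →
      ∀ g : L ⟶ X, g ≫ q = l → ∃ h : Z ⟶ P, h ≫ r = z ∧ IsTranspose s ev m h g)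
    (ext : ∀ {L Z : C} {l : L ⟶ E} {m : L ⟶ Z} {z : Z ⟶ B}, IsPullback l m p z →
      ∀ (g : L ⟶ X) (h h' : Z ⟶ P), g ≫ q = l → h ≫ r = z → h' ≫ r = z →
        IsTranspose s ev m h g → IsTranspose s ev m h' g → h = h') :
    IsPushforward q p r k s ev where
  isPullback := hK
  ev_comp := hev
  existsUnique hL g hg := by
    obtain ⟨h, hr, hh⟩ := ex hL g hg
    exact ⟨h, ⟨hr, hh⟩, fun h' ⟨hr', hh'⟩ => ext hL g h' h hg hr' hr hh' hh⟩

end Pushforward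

/-! ### Exponentiable maps are stable under base change and composition. -/

section Stability

variable {C : Type u} [Category.{v} C]

theorem IsTranspose.trans {X P K L Z P' K' : C} {s : K ⟶ P} {ev : K ⟶ X} {m : L ⟶ Z}
    {h : Z ⟶ P} {g : L ⟶ X} (H : IsTranspose s ev m h g) {s' : K' ⟶ P'} {ev' : K' ⟶ X}
    {b : P ⟶ P'} (H' : IsTranspose s' ev' s b ev) : IsTranspose s' ev' m (h ≫ b) g := by
  simpa using H.postcomp (a := 𝟙 X) (by simpa using H')

/-- Maps to `X` over `E` are maps over `E'` whose composite with `q` is prescribed. The prescription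
is imposed inside the pushforward `Q` of `e` along `π`, where `ι : B ⟶ Q` transposes the identity of
`E`; the result is `P₁ ×_Q B`. -/
theorem HasPushforwards.of_isPullback [HasPullbacks C] {E B E' B' : C} {e : E ⟶ E'} {p : E ⟶ B}
    {π : E' ⟶ B'} {b : B ⟶ B'} (hπ : HasPushforwards π) (sq : IsPullback e p π b) :
    HasPushforwards p := by
  intro X q
  obtain ⟨P₁, K₁, r₁, k₁, s₁, ev₁, H₁⟩ := hπ _ (q ≫ e)
  obtain ⟨Q, KQ, rQ, kQ, sQ, evQ, HQ⟩ := hπ _ e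
  obtain ⟨φ, hφ, Tφ⟩ := HQ.exists_lift H₁.isPullback (ev₁ ≫ q) (by simp [H₁.ev_comp])
  obtain ⟨ι, hι, Tι⟩ := HQ.exists_lift sq (𝟙 E) (by simp)
  have hP := IsPullback.of_hasPullback φ ι
  generalize pullback.fst φ ι = a at hP
  generalize pullback.snd φ ι = r at hP
  have hK := IsPullback.of_hasPullback p r
  generalize pullback.fst p r = k at hK
  generalize pullback.snd p r = s at hK
  have hKK := hK.paste_horiz sq
  have hr : r ≫ b = a ≫ r₁ := by rw [← hι, ← hφ, reassoc_of% hP.w]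
  obtain ⟨t, ht₁, ht₂⟩ := H₁.isPullback.exists_lift (k ≫ e) (s ≫ a) (by
    rw [hKK.w, hr, Category.assoc])
  have Tt : IsTranspose s₁ ev₁ s a (t ≫ ev₁) := ⟨t, ht₂, rfl⟩
  have hev : (t ≫ ev₁) ≫ q = k := by
    refine HQ.isTranspose_unique (m := s) (h := a ≫ φ) ?_ (Tt.postcomp Tφ) ?_
    · simp [H₁.ev_comp, ht₁]
    · rw [hP.w]
      simpa using Tι.precomp hK.w
  refine ⟨_, _, r, k, s, t ≫ ev₁, IsPushforward.of_exists_of_ext hK hev ?_ ?_⟩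
  · intro L Z l m z hL g hg
    have hLL := hL.paste_horiz sq
    obtain ⟨h₁, hr₁, T₁⟩ := H₁.exists_lift hLL g (by rw [← hg, Category.assoc])
    have hQ : h₁ ≫ φ = z ≫ ι := by
      refine HQ.hom_ext hLL (g := l) rfl ?_ ?_ ?_ ?_
      · rw [Category.assoc, hφ, hr₁]
      · rw [Category.assoc, hι]
      · rw [← hg]
        exact T₁.postcomp Tφ
      · simpa using Tι.precomp hL.w
    obtain ⟨h, rfl, hz⟩ := hP.exists_lift h₁ z hQ
    obtain ⟨t', ht', ht''⟩ := hK.exists_lift l (m ≫ h) (by rw [hL.w, Category.assoc, hz])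
    refine ⟨h, hz, t', ht'', H₁.isTranspose_unique ?_ (IsTranspose.trans ⟨t', ht'', rfl⟩ Tt) T₁⟩
    have := congrArg (t' ≫ · ≫ e) hev
    simpa [reassoc_of% ht', reassoc_of% hg] using this
  · intro L Z l m z hL g h h' hg hz hz' hh hh'
    refine hP.hom_ext ?_ (hz.trans hz'.symm)
    refine H₁.hom_ext (hL.paste_horiz sq) (g := g) ?_ ?_ ?_ (hh.trans Tt) (hh'.trans Tt)
    · rw [← hg, Category.assoc]
    · rw [Category.assoc, ← hr, reassoc_of% hz]
    · rw [Category.assoc, ← hr, reassoc_of% hz']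

/-- Pushing forward along `p` and then along `p'` works because a pullback of `p ≫ p'` splits
through the pullback `W` of `p'`, so transposition is done in two steps. -/
theorem HasPushforwards.comp [HasPullbacks C] {E B D : C} {p : E ⟶ B} {p' : B ⟶ D}
    (hp : HasPushforwards p) (hp' : HasPushforwards p') : HasPushforwards (p ≫ p') := by
  intro X q
  obtain ⟨P, K, r, k, s, ev, H⟩ := hp _ q
  obtain ⟨P', K', r', k', s', ev', H'⟩ := hp' _ r
  have hK := IsPullback.of_hasPullback s ev'
  generalize pullback.fst s ev' = c at hK
  generalize pullback.snd s ev' = d at hK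
  have hKE := hK.paste_horiz H.isPullback
  rw [H'.ev_comp] at hKE
  refine ⟨P', _, r', c ≫ k, d ≫ s', c ≫ ev, IsPushforward.of_exists_of_ext
    (hKE.paste_vert H'.isPullback) (by rw [Category.assoc, H.ev_comp]) ?_ ?_⟩
  · intro L Z l m z hL g hg
    have hW := IsPullback.of_hasPullback p' z
    generalize pullback.fst p' z = w at hW
    generalize pullback.snd p' z = y at hW
    obtain ⟨n, hn₁, hn₂⟩ := hW.exists_lift (l ≫ p) m (by simpa using hL.w)
    subst hn₂
    have hn := IsPullback.of_bot hL hn₁.symm hW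
    obtain ⟨h₁, hr₁, t₁, ht₁, ht₁'⟩ := H.exists_lift hn g hg
    obtain ⟨h, hr, t₂, ht₂, ht₂'⟩ := H'.exists_lift hW h₁ hr₁
    obtain ⟨t, htc, htd⟩ := hK.exists_lift t₁ (n ≫ t₂) (by rw [ht₁, Category.assoc, ht₂'])
    exact ⟨h, hr, t, by rw [reassoc_of% htd, ht₂, Category.assoc], by rw [reassoc_of% htc, ht₁']⟩
  · intro L Z l m z hL g h h' hg hz hz' hh hh'
    have hW := IsPullback.of_hasPullback p' z
    generalize pullback.fst p' z = w at hW
    generalize pullback.snd p' z = y at hW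
    obtain ⟨n, hn₁, hn₂⟩ := hW.exists_lift (l ≫ p) m (by simpa using hL.w)
    subst hn₂
    have hn := IsPullback.of_bot hL hn₁.symm hW
    -- Conversely, a transpose for the composite factors through an intermediate transpose `h₁` on
    -- `W`, so uniqueness follows from the two given uniqueness properties.
    have key {h : Z ⟶ P'} (hz : h ≫ r' = z)
        (hh : IsTranspose (d ≫ s') (c ≫ ev) (n ≫ y) h g) :
        ∃ h₁, h₁ ≫ r = w ∧ IsTranspose s ev n h₁ g ∧ IsTranspose s' ev' y h h₁ := by
      obtain ⟨t, ht, ht'⟩ := hh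
      obtain ⟨t₂, ht₂, ht₂'⟩ := H'.isPullback.exists_lift w (y ≫ h) (by
        rw [hW.w, Category.assoc, hz])
      refine ⟨t₂ ≫ ev', by rw [Category.assoc, H'.ev_comp, ht₂], ⟨t ≫ c, ?_, by simpa using ht'⟩,
        t₂, ht₂', rfl⟩
      have : n ≫ t₂ = t ≫ d := by
        refine H'.isPullback.hom_ext ?_ ?_
        · rw [Category.assoc, ht₂, hn₁, Category.assoc, ← hKE.w, ← H.ev_comp, ← hg, ← ht']
          simp only [Category.assoc]
        · rw [Category.assoc, ht₂', Category.assoc, ht, Category.assoc]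
      rw [reassoc_of% this, Category.assoc, hK.w]
    obtain ⟨h₁, e₁, T₁, S₁⟩ := key hz hh
    obtain ⟨h₂, e₂, T₂, S₂⟩ := key hz' hh'
    obtain rfl := H.hom_ext hn hg e₁ e₂ T₁ T₂
    exact H'.hom_ext hW e₁ hz hz' S₁ S₂

end Stability

/-! ### Closure properties of fibrations. -/

section Fibrations

variable {C : Type u} [Category.{v} C]

theorem IsFibration.hasPushforwards [HasPullbacks C] {E B X Y : C} {π : E ⟶ B} {f : X ⟶ Y}
    (hf : IsFibration π f) (hπ : HasPushforwards π) : HasPushforwards f :=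
  hf.elim fun F => hπ.of_isPullback F.isPullback

theorem IsFibration.of_isPullback {E B X Y X' Y' : C} {π : E ⟶ B} {f : X ⟶ Y} {f' : X' ⟶ Y'}
    {a : X' ⟶ X} {b : Y' ⟶ Y} (hf : IsFibration π f) (sq : IsPullback a f' f b) :
    IsFibration π f' :=
  hf.elim fun F => ⟨⟨b ≫ F.name, a ≫ F.point, sq.paste_horiz F.isPullback⟩⟩

theorem IsFibration.trans {E B E' B' X Y : C} {π : E ⟶ B} {π' : E' ⟶ B'} {f : X ⟶ Y}
    (hf : IsFibration π' f) (hπ' : IsFibration π π') : IsFibration π f :=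
  hf.elim fun F => hπ'.of_isPullback F.isPullback

end Fibrations

/-! ### Polynomial functors, `Π`-types and the generic composite. -/

section Polynomials

variable {C : Type u} [Category.{v} C] [HasFiniteLimits C] {E B : C} {p : E ⟶ B}
  (e : UniversalMap p)

/-- The evaluation `p^* p_*(E × X) ⟶ E × X`. -/
noncomputable def polyEv (X : C) : genCompMid e X ⟶ E ⨯ X :=
  (e.pullPushAdj.counit.app (Over.mk (prod.fst : E ⨯ X ⟶ E))).left

theorem polyEv_snd (X : C) : polyEv e X ≫ prod.snd = evMap e X := rfl

theorem isPushforward_poly (X : C) : IsPushforward (prod.fst : E ⨯ X ⟶ E) p (polyProj e X)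
    (genCompMidProj e X) (genCompSnd e X) (polyEv e X) :=
  e.isPushforward (Over.mk (prod.fst : E ⨯ X ⟶ E))

theorem polyMap_polyProj {X Y : C} (g : X ⟶ Y) : polyMap e g ≫ polyProj e Y = polyProj e X :=
  Over.w (e.push.map _)

theorem isTranspose_polyMap {X Y : C} (g : X ⟶ Y) :
    IsTranspose (genCompSnd e Y) (polyEv e Y) (genCompSnd e X) (polyMap e g)
      (polyEv e X ≫ prod.map (𝟙 E) g) := by
  let f : Over.mk (prod.fst : E ⨯ X ⟶ E) ⟶ Over.mk (prod.fst : E ⨯ Y ⟶ E) :=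
    Over.homMk (prod.map (𝟙 E) g) (by simp)
  exact ⟨(e.pull.map (e.push.map f)).left,
    congrArg (fun y => y.left) (e.mapPullAdj.counit.naturality (e.push.map f)),
    congrArg (fun y => y.left) (e.pullPushAdj.counit.naturality f)⟩

/-- With `Π`-types, pushforwards of fibrations along fibrations are fibrations. -/
theorem isFibration_of_isPushforward (Pi : PiStructure e) {X A D P K : C} {q : X ⟶ A}
    {f : A ⟶ D} {r : P ⟶ D} {k : K ⟶ A} {s : K ⟶ P} {ev : K ⟶ X}
    (H : IsPushforward q f r k s ev) (hq : IsFibration p q) (hf : IsFibration p f) :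
    IsFibration p r := by
  obtain ⟨⟨a, x, hx⟩⟩ := hq
  obtain ⟨⟨b, y, hy⟩⟩ := hf
  have HE := isPushforward_poly e E
  have HB := isPushforward_poly e B
  obtain ⟨n, hn, Tn⟩ := HB.exists_lift hy (prod.lift y a) (prod.lift_fst _ _)
  have hK := H.isPullback.paste_horiz hy
  -- The map `n` names the family `q` over the fibres of `f`; the map `c` sends a section of `q` to
  -- its family of points in `E`.
  obtain ⟨c, hc, Tc⟩ := HE.exists_lift hK (ev ≫ prod.lift (q ≫ y) x) (by
    rw [Category.assoc, prod.lift_fst, reassoc_of% H.ev_comp])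
  -- The map `r` is the pullback of `polyMap e p` along `n`: after transposition, each clause of the
  -- universal property reduces to the square `hx` exhibiting `q` as a pullback of `p`.
  refine IsFibration.of_isPullback ⟨Pi⟩ (a := c) (b := n) (IsPullback.mk' ?_ ?_ ?_)
  · refine HB.hom_ext hK (g := prod.lift (k ≫ y) (k ≫ a)) (prod.lift_fst _ _) ?_ ?_ ?_ ?_
    · rw [Category.assoc, polyMap_polyProj, hc]
    · rw [Category.assoc, hn]
    · simpa [hx.w, reassoc_of% H.ev_comp] using Tc.postcomp (isTranspose_polyMap e p)
    · simpa using Tn.precomp H.isPullback.w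
  · intro Z h h' h₁ h₂
    have hL := IsPullback.of_hasPullback f (h ≫ r)
    generalize pullback.fst f (h ≫ r) = l at hL
    generalize pullback.snd f (h ≫ r) = m at hL
    obtain ⟨g, hg, Tg⟩ := H.exists_transpose hL.w
    obtain ⟨g', hg', Tg'⟩ := H.exists_transpose (h := h') (by rw [← h₂, hL.w])
    have hgg : g ≫ prod.lift (q ≫ y) x = g' ≫ prod.lift (q ≫ y) x := by
      have T' := Tg'.postcomp Tc
      rw [← h₁] at T'
      refine HE.isTranspose_unique ?_ (Tg.postcomp Tc) T'
      rw [Category.assoc, Category.assoc, prod.lift_fst, reassoc_of% hg, reassoc_of% hg']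
    have hgx := congrArg (· ≫ prod.snd) hgg
    simp only [Category.assoc, prod.lift_snd] at hgx
    obtain rfl := hx.hom_ext hgx (hg.trans hg'.symm)
    exact H.hom_ext hL hg rfl h₂.symm Tg Tg'
  · intro Z c' z w
    have hL := IsPullback.of_hasPullback f z
    generalize pullback.fst f z = l at hL
    generalize pullback.snd f z = m at hL
    have hLL := hL.paste_horiz hy
    have hc' : c' ≫ polyProj e E = z ≫ b := by
      rw [← polyMap_polyProj e p, reassoc_of% w, hn]
    obtain ⟨g, hg, Tg⟩ := HE.exists_transpose (h := c') (by rw [hc', hLL.w])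
    have hgx : (g ≫ prod.snd) ≫ p = l ≫ a := by
      have := HB.isTranspose_unique ?_ (Tg.postcomp (isTranspose_polyMap e p))
        (w ▸ Tn.precomp hL.w)
      · have := congrArg (· ≫ prod.snd) this
        simpa only [Category.assoc, prod.map_snd, prod.lift_snd] using this
      · simp only [Category.assoc, prod.map_fst, prod.lift_fst, Category.comp_id, hg]
    obtain ⟨g', hg', hg''⟩ := hx.exists_lift _ _ hgx
    obtain ⟨h, hh, Th⟩ := H.exists_lift hL g' hg''
    refine ⟨h, HE.hom_ext hLL hg ?_ hc' ?_ Tg, hh⟩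
    · rw [Category.assoc, hc, reassoc_of% hh]
    · convert Th.postcomp Tc using 1
      ext
      · rw [hg, Category.assoc, prod.lift_fst, reassoc_of% hg'']
      · rw [Category.assoc, prod.lift_snd, hg']

/-- The projection of the domain of the generic composite to the domain of `π₁`. -/
noncomputable def genCompVar {E₁ B₁ : C} (π₁ : E₁ ⟶ B₁) : genCompTop e π₁ ⟶ E₁ :=
  pullback.snd (evMap e B₁) π₁

theorem isPullback_genCompFst {E₁ B₁ : C} (π₁ : E₁ ⟶ B₁) :
    IsPullback (genCompVar e π₁) (genCompFst e π₁) π₁ (evMap e B₁) :=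
  (IsPullback.of_hasPullback _ _).flip

/-- A fibration `g` followed by a pullback of `p` is a pullback of the generic composite. -/
theorem exists_isPullback_genComp {E₁ B₁ : C} {π₁ : E₁ ⟶ B₁} {W L Z : C} {g : W ⟶ L} {l : L ⟶ E}
    {m : L ⟶ Z} {z : Z ⟶ B} (hL : IsPullback l m p z) (hg : IsFibration π₁ g) :
    ∃ (A : Z ⟶ poly e B₁) (x : W ⟶ genCompTop e π₁), A ≫ polyProj e B₁ = z ∧
      x ≫ genCompFst e π₁ ≫ genCompMidProj e B₁ = g ≫ l ∧
      IsPullback x (g ≫ m) (genComp e π₁) A := by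
  have H := isPushforward_poly e B₁
  obtain ⟨a, x, hx⟩ := hg
  obtain ⟨A, hA, t, ht, ht'⟩ := H.exists_lift hL (prod.lift l a) (prod.lift_fst _ _)
  -- The transpose of `(l, a)` makes evaluation restrict to the name `a` along `t`, so pasting a
  -- pullback of `π₁` on one of `p` gives the generic composite.
  have htk : t ≫ genCompMidProj e B₁ = l := by
    rw [← H.ev_comp, reassoc_of% ht', prod.lift_fst]
  have hev : t ≫ evMap e B₁ = a := by
    rw [← polyEv_snd, reassoc_of% ht', prod.lift_snd]
  have hT : IsPullback t m (genCompSnd e B₁) A :=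
    IsPullback.of_right (by rwa [htk, hA]) ht H.isPullback
  have htop := isPullback_genCompFst e π₁
  obtain ⟨x', hx', hx''⟩ := htop.exists_lift x (g ≫ t) (by
    rw [hx.w, Category.assoc, hev])
  have hX : IsPullback x' g (genCompFst e π₁) t :=
    IsPullback.of_right (by rwa [hx', hev]) hx'' htop
  refine ⟨A, x', hA, ?_, hX.paste_vert hT⟩
  rw [reassoc_of% hx'', htk]

/-- If a map `g` followed by a pullback of `p` is a pullback of the generic composite, then `g` is
a fibration. -/
theorem isFibration_of_isPullback_genComp {E₁ B₁ : C} {π₁ : E₁ ⟶ B₁} {W L Z : C} {g : W ⟶ L}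
    {l : L ⟶ E} {m : L ⟶ Z} {z : Z ⟶ B} (hL : IsPullback l m p z) {A : Z ⟶ poly e B₁}
    {x : W ⟶ genCompTop e π₁} (hA : A ≫ polyProj e B₁ = z)
    (hx : x ≫ genCompFst e π₁ ≫ genCompMidProj e B₁ = g ≫ l)
    (hW : IsPullback x (g ≫ m) (genComp e π₁) A) : IsFibration π₁ g := by
  have H := isPushforward_poly e B₁
  obtain ⟨t, ht, ht'⟩ := H.isPullback.exists_lift l (m ≫ A) (by rw [hL.w, Category.assoc, hA])
  have hT : IsPullback t m (genCompSnd e B₁) A :=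
    IsPullback.of_right (by rwa [ht, hA]) ht' H.isPullback
  have hX : IsPullback x g (genCompFst e π₁) t := by
    refine IsPullback.of_bot hW (H.isPullback.hom_ext ?_ ?_) hT
    · rw [Category.assoc, hx, Category.assoc, ht]
    · rw [Category.assoc, Category.assoc, ht', ← Category.assoc g]
      exact hW.w
  exact ⟨⟨_, _, hX.paste_horiz (isPullback_genCompFst e π₁)⟩⟩

end Polynomials

/-! ### Universe structures from arbitrary choices of pullbacks. -/

section PullbackChoices

variable {C : Type u} [Category.{v} C] {E B : C}

/-- A choice of a pullback of `π` along `A`. -/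
structure PullbackChoice (π : E ⟶ B) {Γ : C} (A : Γ ⟶ B) where
  obj : C
  disp : obj ⟶ Γ
  var : obj ⟶ E
  isPullback : IsPullback var disp π A

/-- The choice of pullback provided by a fibrancy structure. -/
def FibrancyStructure.pullbackChoice {π : E ⟶ B} {X Y : C} {f : X ⟶ Y}
    (F : FibrancyStructure π f) : PullbackChoice π F.name :=
  ⟨X, f, F.point, F.isPullback⟩

variable {π : E ⟶ B}

/-- The hom-set bijection that makes a choice of pullbacks of `π` right adjoint to
postcomposition with `π`. -/
noncomputable def mapEquivOfPullbackChoice (c : ∀ A : Over B, PullbackChoice π A.hom) (X : Over E)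
    (Y : Over B) : ((Over.map π).obj X ⟶ Y) ≃ (X ⟶ Over.mk (c Y).var) where
  toFun g := Over.homMk ((c Y).isPullback.lift X.hom g.left (Over.w g).symm)
    ((c Y).isPullback.lift_fst _ _ _)
  invFun h := Over.homMk (h.left ≫ (c Y).disp) (by
    have : h.left ≫ (c Y).var = X.hom := Over.w h
    simp [← (c Y).isPullback.w, reassoc_of% this])
  left_inv g := by
    ext
    exact (c Y).isPullback.lift_snd _ _ _
  right_inv h := by
    ext
    apply (c Y).isPullback.hom_ext
    · exact ((c Y).isPullback.lift_fst _ _ _).trans (Over.w h).symm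
    · exact (c Y).isPullback.lift_snd _ _ _

/-- The chosen pullbacks along `π` given on objects by `c`. -/
@[reducible]
noncomputable def chosenPullbacksAlongOfChoice (c : ∀ A : Over B, PullbackChoice π A.hom) :
    ChosenPullbacksAlong π where
  pullback := Adjunction.rightAdjointOfEquiv (mapEquivOfPullbackChoice c) (by
    intro X' X Y f g
    ext
    apply (c Y).isPullback.hom_ext <;> simp [mapEquivOfPullbackChoice])
  mapPullbackAdj := Adjunction.adjunctionOfEquivRight _ _

/-- The universal map with underlying map `π` and universe structure given by `c`. -/
noncomputable def UniversalMap.ofChoice (hπ : HasPushforwards π)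
    (c : ∀ A : Over B, PullbackChoice π A.hom) : UniversalMap π :=
  letI := chosenPullbacksAlongOfChoice c
  haveI := hπ.isLeftAdjoint (ChosenPullbacksAlong.mapPullbackAdj π)
  { pullbacks := chosenPullbacksAlongOfChoice c
    pushforwards :=
      ⟨(ChosenPullbacksAlong.pullback π).rightAdjoint, Adjunction.ofIsLeftAdjoint _⟩ }

theorem UniversalMap.isCanonical_ofChoice (hπ : HasPushforwards π)
    (c : ∀ A : Over B, PullbackChoice π A.hom) {Γ : C} (A : Γ ⟶ B) :
    (UniversalMap.ofChoice hπ c).IsCanonical (c (Over.mk A)).disp A (c (Over.mk A)).var := by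
  have h := UniversalMap.IsCanonical.selected (u := UniversalMap.ofChoice hπ c) A
  -- The counit is the inverse transpose of an identity, hence `𝟙 _ ≫ disp`.
  have e : (UniversalMap.ofChoice hπ c).disp A = (c (Over.mk A)).disp := Category.id_comp _
  rw [e] at h
  exact h

theorem HasPushforwards.nonempty_universalMap [HasPullbacks C] (hπ : HasPushforwards π) :
    Nonempty (UniversalMap π) :=
  ⟨UniversalMap.ofChoice hπ fun A => ⟨_, _, _, IsPullback.of_hasPullback π A.hom⟩⟩

open Classical in
/-- An exponentiable map has a universe structure that selects a given fibrancy structure, and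
a second one if the names of the two are different. -/
theorem HasPushforwards.exists_isCanonical [HasPullbacks C] (hπ : HasPushforwards π)
    {X Y X' Y' : C} {f : X ⟶ Y} {f' : X' ⟶ Y'} (F : FibrancyStructure π f)
    (F' : FibrancyStructure π f') : ∃ V : UniversalMap π, V.IsCanonical f F.name F.point ∧
      (Over.mk F'.name ≠ Over.mk F.name → V.IsCanonical f' F'.name F'.point) := by
  let c₀ (A : Over B) : PullbackChoice π A.hom := ⟨_, _, _, IsPullback.of_hasPullback π A.hom⟩
  -- The update at `F` is outermost and wins when the names agree, so `F'` is selected only for a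
  -- different name.
  let c := Function.update (Function.update c₀ (Over.mk F'.name) F'.pullbackChoice)
    (Over.mk F.name) F.pullbackChoice
  refine ⟨UniversalMap.ofChoice hπ c, ?_, fun hne => ?_⟩
  · have := UniversalMap.isCanonical_ofChoice hπ c F.name
    rw [show c (Over.mk F.name) = F.pullbackChoice from Function.update_self ..] at this
    exact this
  · have := UniversalMap.isCanonical_ofChoice hπ c F'.name
    rw [show c (Over.mk F'.name) = F'.pullbackChoice by simp [c, hne]] at this
    exact this

/-- A universal map `π'` such that `π'` and the map from its codomain to a terminal object are
`π`-fibrations is an internal universe for some universe structure on `π`. -/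
theorem HasPushforwards.exists_internalUniverse [HasPullbacks C] (hπ : HasPushforwards π)
    {E' B' one : C} {π' : E' ⟶ B'} (u : UniversalMap π') (hone : IsTerminal one)
    (hel : IsFibration π π') (hbase : IsFibration π (hone.from B')) :
    ∃ V : UniversalMap π, Nonempty (InternalUniverse V π') := by
  obtain ⟨F⟩ := hel
  obtain ⟨G⟩ := hbase
  by_cases h : Over.mk G.name = Over.mk F.name
  -- If the names coincide, one selected pullback would have to serve both maps. Being pullbacks
  -- along the same name, they have isomorphic domains, so `E'` is terminal too.
  · obtain rfl : one = B' := congrArg (fun A => A.left) h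
    have hname : G.name = F.name := by
      have aux : ∀ {A A' : Over B}, A = A' → A.hom ≍ A'.hom := by
        rintro _ _ rfl
        rfl
      exact eq_of_heq (aux h)
    have hG := G.isPullback
    rw [hname] at hG
    have hE' : IsTerminal E' := hone.ofIso (hG.isoIsPullback _ _ F.isPullback)
    by_cases hEB : E' = one
    · subst hEB
      obtain ⟨V, hV, -⟩ := hπ.exists_isCanonical F F
      have hid : hone.from E' = π' := hone.hom_ext _ _
      exact ⟨V, ⟨⟨u, E', hone, ⟨F, hV⟩, hid ▸ ⟨F, hV⟩⟩⟩⟩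
    -- Taking `E'` as the terminal object instead gives the second map a name with domain `E' ≠
    -- one`, so the two names no longer collide.
    · have sq : IsPullback (𝟙 one) (hE'.from one) (hone.from one) π' :=
        haveI : IsIso π' := isIso_of_isTerminal hE' hone π'
        haveI : IsIso (hone.from one) := isIso_of_isTerminal hone hone _
        IsPullback.of_horiz_isIso_mono ⟨hone.hom_ext _ _⟩
      let G' : FibrancyStructure π (hE'.from one) := ⟨_, _, sq.paste_horiz hG⟩
      obtain ⟨V, h₁, h₂⟩ := hπ.exists_isCanonical F G'
      exact ⟨V, ⟨⟨u, E', hE', ⟨F, h₁⟩,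
        ⟨G', h₂ fun h => hEB (congrArg (fun A => A.left) h)⟩⟩⟩⟩
  · obtain ⟨V, h₁, h₂⟩ := hπ.exists_isCanonical F G
    exact ⟨V, ⟨⟨u, one, hone, ⟨F, h₁⟩, ⟨G, h₂ h⟩⟩⟩⟩

end PullbackChoices

/-! ### Pullbacks and pushforwards in the gluing category. -/

section GluingPullbacks

variable {C₀ : Type u₀} [Category.{v₀} C₀] {C₁ : Type u₁} [Category.{v₁} C₁] {M : C₀ ⥤ C₁}

theorem Gl.hom_w {X Y : Gl M} (f : X ⟶ Y) : f.left ≫ Y.hom = X.hom ≫ M.map f.right := f.w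

theorem Gl.left_w {X Y Y' Z : Gl M} {f : X ⟶ Y} {g : Y ⟶ Z} {f' : X ⟶ Y'} {g' : Y' ⟶ Z}
    (w : f ≫ g = f' ≫ g') : f.left ≫ g.left = f'.left ≫ g'.left :=
  congrArg (fun x => x.left) w

theorem Gl.right_w {X Y Y' Z : Gl M} {f : X ⟶ Y} {g : Y ⟶ Z} {f' : X ⟶ Y'} {g' : Y' ⟶ Z}
    (w : f ≫ g = f' ≫ g') : f.right ≫ g.right = f'.right ≫ g'.right :=
  congrArg (fun x => x.right) w

variable [PreservesFiniteLimits M]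

/-- Compatibility of the lift with structure maps is checked in the `M`-image of the 0-component
square, again a pullback. -/
theorem Gl.isPullback_of_components {P X Y Z : Gl M} {a : P ⟶ X} {b : P ⟶ Y} {f : X ⟶ Z}
    {g : Y ⟶ Z} (hl : IsPullback a.left b.left f.left g.left)
    (hr : IsPullback a.right b.right f.right g.right) : IsPullback a b f g := by
  refine IsPullback.mk' ?_ ?_ ?_
  · ext
    exacts [hl.w, hr.w]
  · intro T φ φ' h₁ h₂
    ext
    · exact hl.hom_ext (congrArg (fun x => x.left) h₁) (congrArg (fun x => x.left) h₂)
    · exact hr.hom_ext (congrArg (fun x => x.right) h₁) (congrArg (fun x => x.right) h₂)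
  · intro T x y w
    obtain ⟨l, hl₁, hl₂⟩ := hl.exists_lift x.left y.left (Gl.left_w w)
    obtain ⟨r, hr₁, hr₂⟩ := hr.exists_lift x.right y.right (Gl.right_w w)
    refine ⟨⟨l, r, ?_⟩, ?_, ?_⟩
    · refine (hr.map M).hom_ext ?_ ?_
      · simp [← Gl.hom_w, ← Functor.map_comp, hr₁, reassoc_of% hl₁]
      · simp [← Gl.hom_w, ← Functor.map_comp, hr₂, reassoc_of% hl₂]
    · ext <;> assumption
    · ext <;> assumption

variable [HasFiniteLimits C₀] [HasFiniteLimits C₁]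

/-- The componentwise pullback in the gluing category. -/
theorem Gl.exists_isPullback {X Y Z : Gl M} (f : X ⟶ Z) (g : Y ⟶ Z) :
    ∃ (P : Gl M) (a : P ⟶ X) (b : P ⟶ Y), IsPullback a.left b.left f.left g.left ∧
      IsPullback a.right b.right f.right g.right := by
  have hl := IsPullback.of_hasPullback f.left g.left
  have hr := IsPullback.of_hasPullback f.right g.right
  obtain ⟨h, h₁, h₂⟩ := (hr.map M).exists_lift (pullback.fst f.left g.left ≫ X.hom)
    (pullback.snd f.left g.left ≫ Y.hom) (by
      rw [Category.assoc, ← Gl.hom_w, Category.assoc, ← Gl.hom_w, reassoc_of% hl.w])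
  exact ⟨⟨_, _, h⟩, ⟨_, _, h₁.symm⟩, ⟨_, _, h₂.symm⟩, hl, hr⟩

theorem Gl.isPullback_components {P X Y Z : Gl M} {a : P ⟶ X} {b : P ⟶ Y} {f : X ⟶ Z}
    {g : Y ⟶ Z} (h : IsPullback a b f g) : IsPullback a.left b.left f.left g.left ∧
      IsPullback a.right b.right f.right g.right := by
  obtain ⟨P', a', b', hl, hr⟩ := Gl.exists_isPullback f g
  let i := h.isoIsPullback _ _ (Gl.isPullback_of_components hl hr)
  have h₁ : i.hom ≫ a' = a := h.isoIsPullback_hom_fst _ _ _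
  have h₂ : i.hom ≫ b' = b := h.isoIsPullback_hom_snd _ _ _
  exact ⟨hl.of_iso ((Comma.fst _ _).mapIso i).symm (Iso.refl _) (Iso.refl _) (Iso.refl _)
      (by simp [← h₁]) (by simp [← h₂]) (by simp) (by simp),
    hr.of_iso ((Comma.snd _ _).mapIso i).symm (Iso.refl _) (Iso.refl _) (Iso.refl _)
      (by simp [← h₁]) (by simp [← h₂]) (by simp) (by simp)⟩

/-- A map of the gluing category is exponentiable if its components are. -/
theorem Gl.hasPushforwards {Y X : Gl M} {f : Y ⟶ X} (hl : HasPushforwards f.left)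
    (hr : HasPushforwards f.right) : HasPushforwards f := by
  intro Z q
  obtain ⟨P₀, K₀, r₀, k₀, s₀, ev₀, H₀⟩ := hr _ q.right
  have hMK := H₀.isPullback.map M
  -- The 1-component will be `A ×_Q R`, with `A = M P₀ ×_{M X₀} X₁`, and `Q` and `R` the
  -- pushforwards along `f.left` of `N = M Z₀ ×_{M Y₀} Y₁` and of `Z₁`. Thus a section of `Z₁` must
  -- induce in `N` the section determined by `M P₀`.
  have hN := IsPullback.of_hasPullback (M.map q.right) Y.hom
  generalize pullback.fst (M.map q.right) Y.hom = nZ at hN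
  generalize pullback.snd (M.map q.right) Y.hom = n at hN
  obtain ⟨Q, KQ, rQ, kQ, sQ, evQ, HQ⟩ := hl _ n
  obtain ⟨R, KR, rR, kR, sR, evR, HR⟩ := hl _ q.left
  obtain ⟨c, hc₁, hc₂⟩ := hN.exists_lift Z.hom q.left (Gl.hom_w q).symm
  obtain ⟨φ, hφ, Tφ⟩ := HQ.exists_lift HR.isPullback (evR ≫ c) (by
    rw [Category.assoc, hc₂, HR.ev_comp])
  have hA := IsPullback.of_hasPullback (M.map r₀) X.hom
  generalize pullback.fst (M.map r₀) X.hom = aP at hA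
  generalize pullback.snd (M.map r₀) X.hom = aX at hA
  have hLA := IsPullback.of_hasPullback f.left aX
  generalize pullback.fst f.left aX = lY at hLA
  generalize pullback.snd f.left aX = lA at hLA
  obtain ⟨κ, hκ₁, hκ₂⟩ := hMK.exists_lift (lY ≫ Y.hom) (lA ≫ aP) (by
    rw [Category.assoc, ← Gl.hom_w, reassoc_of% hLA.w, Category.assoc, hA.w])
  obtain ⟨gA, hgA₁, hgA₂⟩ := hN.exists_lift (κ ≫ M.map ev₀) lY (by
    rw [Category.assoc, ← Functor.map_comp, H₀.ev_comp, hκ₁])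
  -- While `φ` postcomposes with the matching map `c` of `q`, `ι` comes from the image under `M` of
  -- the evaluation `ev₀`.
  obtain ⟨ι, hι, Tι⟩ := HQ.exists_lift hLA gA hgA₂
  have hP := IsPullback.of_hasPullback ι φ
  generalize pullback.fst ι φ = pA at hP
  generalize pullback.snd ι φ = pR at hP
  have hpR : pR ≫ rR = pA ≫ aX := by rw [← hφ, ← hι, reassoc_of% hP.w]
  let P : Gl M := ⟨_, P₀, pA ≫ aP⟩
  let r : P ⟶ X := ⟨pA ≫ aX, r₀, by simp [P, hA.w]⟩
  have hK₁ := IsPullback.of_hasPullback f.left (pA ≫ aX)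
  generalize pullback.fst f.left (pA ≫ aX) = k₁ at hK₁
  generalize pullback.snd f.left (pA ≫ aX) = s₁ at hK₁
  obtain ⟨κ', hκ'₁, hκ'₂⟩ := hMK.exists_lift (k₁ ≫ Y.hom) (s₁ ≫ pA ≫ aP) (by
    rw [Category.assoc, ← Gl.hom_w, reassoc_of% hK₁.w, Category.assoc, Category.assoc, hA.w])
  let K : Gl M := ⟨_, K₀, κ'⟩
  let k : K ⟶ Y := ⟨k₁, k₀, hκ'₁.symm⟩
  let s : K ⟶ P := ⟨s₁, s₀, hκ'₂.symm⟩
  have hK : IsPullback k s f r := Gl.isPullback_of_components hK₁ H₀.isPullback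
  obtain ⟨t, ht₁, ht₂⟩ := HR.isPullback.exists_lift k₁ (s₁ ≫ pR) (by
    rw [hK₁.w, Category.assoc, hpR])
  have TR : IsTranspose sR evR s₁ pR (t ≫ evR) := ⟨t, ht₂, rfl⟩
  have hev₁ : (t ≫ evR) ≫ q.left = k₁ := by rw [Category.assoc, HR.ev_comp, ht₁]
  obtain ⟨j, hj₁, hj₂⟩ := hLA.exists_lift k₁ (s₁ ≫ pA) (by rw [hK₁.w, Category.assoc])
  have hjκ : j ≫ κ = κ' := by
    refine hMK.hom_ext ?_ ?_
    · rw [Category.assoc, hκ₁, reassoc_of% hj₁, hκ'₁]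
    · rw [Category.assoc, hκ₂, reassoc_of% hj₂, hκ'₂]
  have hjg : (t ≫ evR) ≫ c = j ≫ gA := by
    refine HQ.isTranspose_unique ?_ (TR.postcomp Tφ) (hP.w ▸ Tι.precomp hj₂)
    rw [Category.assoc, hc₂, hev₁, Category.assoc, hgA₂, hj₁]
  let ev : K ⟶ Z := ⟨t ≫ evR, ev₀, by
    change (t ≫ evR) ≫ Z.hom = κ' ≫ M.map ev₀
    rw [← hc₁, ← Category.assoc, hjg, Category.assoc, hgA₁, reassoc_of% hjκ]⟩
  have hev : ev ≫ q = k := by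
    ext
    exacts [hev₁, H₀.ev_comp]
  refine ⟨P, K, r, k, s, ev, IsPushforward.of_exists_of_ext hK hev ?_ ?_⟩
  · intro L W l m z hL g hg
    obtain ⟨hL₁, hL₀⟩ := Gl.isPullback_components hL
    have hg₁ : g.left ≫ q.left = l.left := congrArg (fun x => x.left) hg
    have hg₀ : g.right ≫ q.right = l.right := congrArg (fun x => x.right) hg
    obtain ⟨h₀, hh₀, T₀⟩ := H₀.exists_lift hL₀ g.right hg₀
    obtain ⟨wA, hwA₁, hwA₂⟩ := hA.exists_lift (W.hom ≫ M.map h₀) z.left (by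
      rw [Category.assoc, ← Functor.map_comp, hh₀, Gl.hom_w])
    obtain ⟨wR, hwR, TwR⟩ := HR.exists_lift hL₁ g.left hg₁
    obtain ⟨u, hu₁, hu₂⟩ := hLA.exists_lift l.left (m.left ≫ wA) (by
      rw [hL₁.w, Category.assoc, hwA₂])
    -- This is where the structure-map square of `g` enters: it makes the two components agree in
    -- `Q`.
    have hu : u ≫ gA = g.left ≫ c := by
      obtain ⟨t₀, ht₀, ht₀'⟩ := T₀
      have huκ : u ≫ κ = L.hom ≫ M.map t₀ := by
        refine hMK.hom_ext ?_ ?_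
        · rw [Category.assoc, hκ₁, reassoc_of% hu₁, Gl.hom_w, Category.assoc,
            ← Functor.map_comp, ← H₀.ev_comp, reassoc_of% ht₀', hg₀]
        · rw [Category.assoc, hκ₂, reassoc_of% hu₂, hwA₁, reassoc_of% (Gl.hom_w m), Category.assoc,
            ← Functor.map_comp, ← Functor.map_comp, ht₀]
      refine hN.hom_ext ?_ ?_
      · rw [Category.assoc, hgA₁, reassoc_of% huκ, ← Functor.map_comp, ht₀', Category.assoc,
          hc₁, Gl.hom_w]
      · rw [Category.assoc, hgA₂, hu₁, Category.assoc, hc₂, hg₁]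
    have hw : wA ≫ ι = wR ≫ φ := by
      refine HQ.hom_ext hL₁ (g := g.left ≫ c) ?_ ?_ ?_ (hu ▸ Tι.precomp hu₂) (TwR.postcomp Tφ)
      · rw [Category.assoc, hc₂, hg₁]
      · rw [Category.assoc, hι, hwA₂]
      · rw [Category.assoc, hφ, hwR]
    obtain ⟨h₁, hh₁, hh₁'⟩ := hP.exists_lift wA wR hw
    let h : W ⟶ P := ⟨h₁, h₀, by
      change h₁ ≫ pA ≫ aP = W.hom ≫ M.map h₀
      rw [reassoc_of% hh₁, hwA₁]⟩
    have hhr : h ≫ r = z := by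
      ext
      · change h₁ ≫ pA ≫ aX = z.left
        rw [reassoc_of% hh₁, hwA₂]
      · exact hh₀
    obtain ⟨t', ht', ht''⟩ := hK.exists_lift l (m ≫ h) (by rw [hL.w, Category.assoc, hhr])
    have hg' : (t' ≫ ev) ≫ q = g ≫ q := by rw [Category.assoc, hev, ht', hg]
    refine ⟨h, hhr, t', ht'', ?_⟩
    ext
    · refine HR.isTranspose_unique (congrArg (fun x => x.left) hg') ?_ TwR
      rw [← hh₁']
      exact IsTranspose.trans (s := s₁) ⟨t'.left, congrArg (fun x => x.left) ht'', rfl⟩ TR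
    · exact H₀.isTranspose_unique (congrArg (fun x => x.right) hg')
        ⟨t'.right, congrArg (fun x => x.right) ht'', rfl⟩ T₀
  · intro L W l m z hL g h h' hg hz hz' hh hh'
    obtain ⟨hL₁, hL₀⟩ := Gl.isPullback_components hL
    have hright : h.right = h'.right := by
      obtain ⟨t, ht, ht'⟩ := hh
      obtain ⟨t', ht'', ht'''⟩ := hh'
      exact H₀.hom_ext hL₀ (congrArg (fun x => x.right) hg) (congrArg (fun x => x.right) hz)
        (congrArg (fun x => x.right) hz')
        ⟨t.right, congrArg (fun x => x.right) ht, congrArg (fun x => x.right) ht'⟩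
        ⟨t'.right, congrArg (fun x => x.right) ht'', congrArg (fun x => x.right) ht'''⟩
    have key {h : W ⟶ P} (hh : IsTranspose s ev m h g) :
        IsTranspose sR evR m.left (h.left ≫ pR) g.left := by
      obtain ⟨t, ht, ht'⟩ := hh
      exact IsTranspose.trans (s := s₁)
        ⟨t.left, congrArg (fun x => x.left) ht, congrArg (fun x => x.left) ht'⟩ TR
    have hzl : h.left ≫ pA ≫ aX = z.left := congrArg (fun x => x.left) hz
    have hzl' : h'.left ≫ pA ≫ aX = z.left := congrArg (fun x => x.left) hz'
    have hw : h.left ≫ pA ≫ aP = W.hom ≫ M.map h.right := h.w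
    have hw' : h'.left ≫ pA ≫ aP = W.hom ≫ M.map h'.right := h'.w
    ext
    · refine hP.hom_ext (hA.hom_ext ?_ ?_) ?_
      · rw [Category.assoc, Category.assoc, hw, hw', hright]
      · rw [Category.assoc, Category.assoc, hzl, hzl']
      · refine HR.hom_ext hL₁ (congrArg (fun x => x.left) hg) ?_ ?_ (key hh) (key hh')
        · rw [Category.assoc, hpR, hzl]
        · rw [Category.assoc, hpR, hzl']
    · exact hright

end GluingPullbacks

/-! ### Reedy fibrations and the glued universe. -/

section Reedy

variable {C₀ : Type u₀} [Category.{v₀} C₀] {C₁ : Type u₁} [Category.{v₁} C₁] [HasFiniteLimits C₁]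
  {M : C₀ ⥤ C₁}

/-- The projection of the relative matching object to the 1-component of the codomain. -/
noncomputable def relMatchFst {Y X : Gl M} (f : Y ⟶ X) :
    relMatchObj f ⟶ X.left :=
  pullback.fst X.hom (M.map f.right)

/-- The projection of the relative matching object to the image of the 0-component of the
domain. -/
noncomputable def relMatchSnd {Y X : Gl M} (f : Y ⟶ X) :
    relMatchObj f ⟶ M.obj Y.right :=
  pullback.snd X.hom (M.map f.right)

theorem isPullback_relMatch {Y X : Gl M} (f : Y ⟶ X) :
    IsPullback (relMatchSnd f) (relMatchFst f)
      (M.map f.right) X.hom :=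
  (IsPullback.of_hasPullback _ _).flip

theorem relMatchMap_fst {Y X : Gl M} (f : Y ⟶ X) :
    relMatchMap f ≫ relMatchFst f = f.left :=
  pullback.lift_fst _ _ _

theorem relMatchMap_snd {Y X : Gl M} (f : Y ⟶ X) :
    relMatchMap f ≫ relMatchSnd f = Y.hom :=
  pullback.lift_snd _ _ _

theorem IsReedyFibration.trans {E₀ B₀ E₀' B₀' : C₀} {π₀ : E₀ ⟶ B₀}
    {π₀' : E₀' ⟶ B₀'} {E₁ B₁ E₁' B₁' : C₁} {π₁ : E₁ ⟶ B₁} {π₁' : E₁' ⟶ B₁'} {Y X : Gl M}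
    {f : Y ⟶ X} (hf : IsReedyFibration π₀' π₁' f) (h₀ : IsFibration π₀ π₀')
    (h₁ : IsFibration π₁ π₁') : IsReedyFibration π₀ π₁ f :=
  ⟨hf.1.trans h₀, hf.2.trans h₁⟩

theorem IsFibration.prod_fst {E B : C₁} {π : E ⟶ B} {one Y : C₁} (hone : IsTerminal one)
    (hY : IsFibration π (hone.from Y)) (X : C₁) : IsFibration π (prod.fst : X ⨯ Y ⟶ X) :=
  hY.of_isPullback (a := prod.snd) (b := hone.from X)
    (IsPullback.of_is_product (prodIsProd X Y) hone).flip

theorem IsFibration.of_isTerminal {C : Type u} [Category.{v} C] {E B : C} {π : E ⟶ B}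
    {one one' X : C} (hone : IsTerminal one) (hone' : IsTerminal one') {f : X ⟶ one}
    (hf : IsFibration π f) (f' : X ⟶ one') : IsFibration π f' :=
  haveI := isIso_of_isTerminal hone' hone (hone.from one')
  hf.of_isPullback (a := 𝟙 X) (b := hone.from one')
    (IsPullback.of_horiz_isIso ⟨hone.hom_ext _ _⟩)

variable [PreservesFiniteLimits M]

/-- The codomain of `reedyMap` is Reedy fibrant if the codomains of `π₀'` and `π₁'` are fibrant
and fibrations are closed under pushforward along `M.map π₀'`. -/
theorem isReedyFibration_reedyBase {E₀ B₀ : C₀} {π₀ : E₀ ⟶ B₀} {E₁ B₁ : C₁} {π₁ : E₁ ⟶ B₁}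
    (U₁ : UniversalMap π₁) (Pi₁ : PiStructure U₁) {E₀' B₀' one₀ : C₀} {π₀' : E₀' ⟶ B₀'}
    (hone₀ : IsTerminal one₀) (h₀ : IsFibration π₀ (hone₀.from B₀')) {B₁' one₁ : C₁}
    (hone₁ : IsTerminal one₁) (h₁ : IsFibration π₁ (hone₁.from B₁'))
    (hπ₀' : IsFibration π₁ (M.map π₀')) (e : UniversalMap (M.map π₀')) {T : Gl M}
    (hTl : IsTerminal T.left) (hTr : IsTerminal T.right) (f : reedyBase π₀' e B₁' ⟶ T) :
    IsReedyFibration π₀ π₁ f := by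
  refine ⟨h₀.of_isTerminal hone₀ hTr _, ?_⟩
  -- The projection is the pushforward of `M E₀' × B₁' ⟶ M E₀'`, a base change of `B₁' ⟶ 1`.
  have hproj : IsFibration π₁ (polyProj e B₁') :=
    isFibration_of_isPushforward U₁ Pi₁ (isPushforward_poly e B₁') (h₁.prod_fst hone₁ _) hπ₀'
  have hMT : IsTerminal (M.obj T.right) := hTr.isTerminalObj M _
  -- Over a terminal object the matching map is, up to isomorphism, the structure map of
  -- `reedyBase`.
  have : IsIso T.hom := isIso_of_isTerminal hTl hMT _
  have : IsIso (relMatchSnd f) :=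
    (isPullback_relMatch f).isIso_fst_of_isIso
  exact hproj.of_isPullback (a := 𝟙 _) (b := relMatchSnd f)
    (IsPullback.of_horiz_isIso ⟨(Category.id_comp _).trans (relMatchMap_snd f).symm⟩)

variable [HasFiniteLimits C₀]

/-- The map `reedyMap` classifies Reedy fibrations. -/
theorem isReedyFibration_iff {E₀ B₀ : C₀} {π₀ : E₀ ⟶ B₀} {E₁ B₁ : C₁} {π₁ : E₁ ⟶ B₁}
    (e : UniversalMap (M.map π₀)) {Y X : Gl M} (f : Y ⟶ X) :
    IsReedyFibration π₀ π₁ f ↔ IsFibration (reedyMap π₀ π₁ e) f := by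
  have hR := isPullback_relMatch f
  constructor
  · rintro ⟨⟨n, y, hy⟩, hf⟩
    obtain ⟨A, x, hA, hx, hL⟩ := exists_isPullback_genComp e (hR.paste_horiz (hy.map M)) hf
    rw [← Category.assoc (relMatchMap f), relMatchMap_snd] at hx
    rw [relMatchMap_fst] at hL
    exact ⟨⟨A, n, hA⟩, ⟨x, y, hx⟩,
      Gl.isPullback_of_components hL hy⟩
  · rintro ⟨⟨n, y, hy⟩⟩
    obtain ⟨hl, hr⟩ := Gl.isPullback_components hy
    refine ⟨⟨⟨_, _, hr⟩⟩, isFibration_of_isPullback_genComp e (hR.paste_horiz (hr.map M))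
      (A := n.left) (x := y.left) n.w ?_ ?_⟩
    · exact y.w.trans ((congrArg (· ≫ M.map y.right) (relMatchMap_snd f)).symm.trans
        (Category.assoc _ _ _))
    · rw [relMatchMap_fst]
      exact hl

/-- The 1-component is a pullback of `π₁` followed by a pullback of `M π₀`, both exponentiable. -/
theorem hasPushforwards_reedyMap {E₀ B₀ : C₀} {π₀ : E₀ ⟶ B₀} {E₁ B₁ : C₁} {π₁ : E₁ ⟶ B₁}
    (U₀ : UniversalMap π₀) (U₁ : UniversalMap π₁) (e : UniversalMap (M.map π₀)) :
    HasPushforwards (reedyMap π₀ π₁ e) := by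
  refine Gl.hasPushforwards ?_ U₀.hasPushforwards
  exact (U₁.hasPushforwards.of_isPullback (IsPullback.of_hasPullback _ _).flip).comp
    (e.hasPushforwards.of_isPullback (isPushforward_poly e B₁).isPullback)

theorem isReedyFibration_reedyMap {E₀ B₀ : C₀} (π₀ : E₀ ⟶ B₀) {E₁ B₁ : C₁} (π₁ : E₁ ⟶ B₁)
    (e : UniversalMap (M.map π₀)) : IsReedyFibration π₀ π₁ (reedyMap π₀ π₁ e) :=
  (isReedyFibration_iff e _).mpr
    ⟨⟨𝟙 _, 𝟙 _, IsPullback.of_horiz_isIso ⟨by simp⟩⟩⟩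

/-- The terminal object of the gluing category. -/
theorem Gl.exists_isTerminal : ∃ T : Gl M, Nonempty (IsTerminal T) ∧
    Nonempty (IsTerminal T.left) ∧ Nonempty (IsTerminal T.right) := by
  have hM : IsTerminal (M.obj (⊤_ C₀)) := terminalIsTerminal.isTerminalObj M _
  refine ⟨⟨⊤_ C₁, ⊤_ C₀, hM.from _⟩, ⟨IsTerminal.ofUniqueHom
    (fun X => ⟨terminal.from _, terminal.from _, hM.hom_ext _ _⟩) fun X m => ?_⟩,
    ⟨terminalIsTerminal⟩, ⟨terminalIsTerminal⟩⟩
  exact Comma.hom_ext _ _ (terminalIsTerminal.hom_ext _ _) (terminalIsTerminal.hom_ext _ _)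

end Reedy

end GluedUniverse

open GluedUniverse
theorem mainTheorem5
    {C₀ : Type u₀} [Category.{v₀} C₀] [HasFiniteLimits C₀]
    {C₁ : Type u₁} [Category.{v₁} C₁] [HasFiniteLimits C₁]
    (M : C₀ ⥤ C₁) [PreservesFiniteLimits M]
    -- the universal maps with their internal universes
    {E₀ B₀ : C₀} {π₀ : E₀ ⟶ B₀} (U₀ : UniversalMap π₀)
    {E₁ B₁ : C₁} {π₁ : E₁ ⟶ B₁} (U₁ : UniversalMap π₁)
    {E₀' B₀' : C₀} {π₀' : E₀' ⟶ B₀'} (I₀ : InternalUniverse U₀ π₀')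
    {E₁' B₁' : C₁} {π₁' : E₁' ⟶ B₁'} (I₁ : InternalUniverse U₁ π₁')
    -- `M` takes `π₀`-fibrations to `π₁`-fibrations
    (hM : ∀ {X Y : C₀} (f : X ⟶ Y), IsFibration π₀ f → IsFibration π₁ (M.map f))
    -- `π₁` has a `Π`-type structure
    (Pi₁ : PiStructure U₁) :
    HasFiniteLimits (Gl M) ∧
    -- `M π₀` and `M π₀'` are exponentiable
    Nonempty (UniversalMap (M.map π₀)) ∧ Nonempty (UniversalMap (M.map π₀')) ∧
    -- for all choices of pullbacks and pushforwards along them, with the resulting `τ` and `τ'`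
    ∀ (e : UniversalMap (M.map π₀)) (e' : UniversalMap (M.map π₀')),
      ((reedyMap π₀ π₁ e).right = π₀ ∧ (reedyMap π₀ π₁ e).left = genComp e π₁) ∧
      ((reedyMap π₀' π₁' e').right = π₀' ∧ (reedyMap π₀' π₁' e').left = genComp e' π₁') ∧
      -- `τ` classifies Reedy fibrations
      (∀ {Y X : Gl M} (f : Y ⟶ X),
        IsReedyFibration π₀ π₁ f ↔ IsFibration (reedyMap π₀ π₁ e) f) ∧
      -- `τ'` classifies internal Reedy fibrations
      (∀ {Y X : Gl M} (f : Y ⟶ X),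
        IsReedyFibration π₀' π₁' f ↔ IsFibration (reedyMap π₀' π₁' e') f) ∧
      -- `τ` is a universal map, of which `τ'` is an internal universe
      ∃ V : UniversalMap (reedyMap π₀ π₁ e),
        Nonempty (InternalUniverse V (reedyMap π₀' π₁' e')) := by
  have hel₀ : IsFibration π₀ π₀' := ⟨I₀.el.toFibrancyStructure⟩
  have hel₁ : IsFibration π₁ π₁' := ⟨I₁.el.toFibrancyStructure⟩
  have hπ₀ : IsFibration π₁ (M.map π₀) := hM _ ⟨⟨𝟙 _, 𝟙 _, IsPullback.of_id_fst⟩⟩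
  have hπ₀' : IsFibration π₁ (M.map π₀') := hM _ hel₀
  refine ⟨inferInstance, (hπ₀.hasPushforwards U₁.hasPushforwards).nonempty_universalMap,
    (hπ₀'.hasPushforwards U₁.hasPushforwards).nonempty_universalMap, fun e e' =>
    ⟨⟨rfl, rfl⟩, ⟨rfl, rfl⟩, isReedyFibration_iff e, isReedyFibration_iff e', ?_⟩⟩
  obtain ⟨T, ⟨hT⟩, ⟨hTl⟩, ⟨hTr⟩⟩ := Gl.exists_isTerminal (M := M)
  obtain ⟨u⟩ := (hasPushforwards_reedyMap I₀.univ I₁.univ e').nonempty_universalMap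
  exact (hasPushforwards_reedyMap U₀ U₁ e).exists_internalUniverse u hT
    ((isReedyFibration_iff e _).mp
      ((isReedyFibration_reedyMap π₀' π₁' e').trans hel₀ hel₁))
    ((isReedyFibration_iff e _).mp
      (isReedyFibration_reedyBase U₁ Pi₁ I₀.isTerminal ⟨I₀.base.toFibrancyStructure⟩
        I₁.isTerminal ⟨I₁.base.toFibrancyStructure⟩ hπ₀' e' hTl hTr _))
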